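/- Let $k$ be an algebraically closed field and let $\mathcal A$ be a spectroid over $k$, that is, a $k$-linear category with finite dimensional morphism spaces in which every object has a local endomorphism algebra and distinct objects are not isomorphic. Let $\operatorname{mod}\mathcal A$ be the abelian category of $k$-linear covariant functors from $\mathcal A$ to finite dimensional $k$-vector spaces. For an object $a$ of $\mathcal A$ put $P_a=\operatorname{Hom}_{\mathcal A}(a,-)$ and $I_a=\operatorname{Hom}_k(\operatorname{Hom}_{\mathcal A}(-,a),k)$, both objects of $\operatorname{mod}\mathcal A$. An object $M$ of $\operatorname{mod}\mathcal A$ is finitely generated if there is an epimorphism $\bigoplus_{i=1}^r P_{a_i}\to M$ for some finite family of objects $a_1,\dots,a_r$, and finitely presented if there is such an epimorphism whose kernel is finitely generated. Dually, $M$ is finitely co-generated if there is a monomorphism $M\to\bigoplus_{i=1}^s I_{b_i}$ for some finite family of objects $b_1,\dots,b_s$, and finitely co-presented if there is such a monomorphism whose cokernel is finitely co-generated. A short exact sequence $0\to L\xrightarrow{f}E\xrightarrow{g}N\to0$ in $\operatorname{mod}\mathcal A$ is almost split if $f$ is not a section and every morphism from $L$ in $\operatorname{mod}\mathcal A$ that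 is not a section factors through $f$, and $g$ is not a retraction and every morphism to $N$ in $\operatorname{mod}\mathcal A$ that is not a retraction factors through $g$; it is said to start in $L$ and to end in $N$. Corollary 4.2. Let $M$ be an indecomposable object of $\operatorname{mod}\mathcal A$. (1) If $M$ is not projective in $\operatorname{mod}\mathcal A$, then there is an almost split sequence in $\operatorname{mod}\mathcal A$ ending in $M$ if and only if $M$ is finitely presented. (2) If $M$ is not injective in $\operatorname{mod}\mathcal A$, then there is an almost split sequence in $\operatorname{mod}\mathcal A$ starting in $M$ if and only if $M$ is finitely co-presented. -/

import Mathlib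

open CategoryTheory CategoryTheory.Limits

universe u v

namespace LocFin

/-- A spectroid over `k`: a `k`-linear category with finite dimensional morphism spaces in which
every object has a local endomorphism algebra and distinct objects are not isomorphic. -/
class IsSpectroid (k : Type v) [Field k] (A : Type u) [Category.{v} A] [Preadditive A]
    [Linear k A] : Prop where
  homFinite : ∀ a b : A, Module.Finite k (a ⟶ b)
  local_end : ∀ a : A, IsLocalRing (End a)
  skeletal : Skeletal A

section ModA

variable (k : Type v) [Field k] (A : Type u) [Category.{v} A] [Preadditive A] [Linear k A]

/-- The covariant functors from `A` to `k`-vector spaces that are additive and `k`-linear and take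
finite dimensional values. -/
structure IsLocFinDim (F : A ⥤ ModuleCat.{v} k) : Prop where
  additive : F.Additive
  linear : F.Linear k
  finite : ∀ a : A, Module.Finite k (F.obj a)

/-- `IsLocFinDim` as a property of objects of the category of all functors. -/
def locFinDim : ObjectProperty (A ⥤ ModuleCat.{v} k) := IsLocFinDim k A

/-- The category `mod A` of locally finite dimensional `A`-modules, a full subcategory of the
category of functors from `A` to `k`-vector spaces. -/
abbrev LFDMod := (locFinDim k A).FullSubcategory

variable {k A}

lemma IsLocFinDim.of_jointly_injective {J : Type*} [Finite J] {F : A ⥤ ModuleCat.{v} k}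
    {G : J → A ⥤ ModuleCat.{v} k} (hG : ∀ j, IsLocFinDim k A (G j)) (φ : ∀ j, F ⟶ G j)
    (hφ : ∀ (a : A) (x y : F.obj a), (∀ j, (φ j).app a x = (φ j).app a y) → x = y) :
    IsLocFinDim k A F where
  additive := ⟨by
    intro a b f g
    ext x
    refine hφ _ _ _ fun j => ?_
    have := (hG j).additive
    simp only [ModuleCat.hom_add, LinearMap.add_apply, map_add]
    erw [NatTrans.naturality_apply, NatTrans.naturality_apply, NatTrans.naturality_apply]
    simp⟩
  linear := ⟨by
    intro a b f r
    ext x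
    refine hφ _ _ _ fun j => ?_
    have := (hG j).linear
    simp only [ModuleCat.hom_smul, LinearMap.smul_apply, map_smul]
    erw [NatTrans.naturality_apply, NatTrans.naturality_apply]
    simp⟩
  finite := fun a => by
    have := fun j => (hG j).finite a
    exact Module.Finite.of_injective (LinearMap.pi fun j => ((φ j).app a).hom)
      fun x y h => hφ a x y fun j => congrFun h j

lemma IsLocFinDim.of_surjective {F G : A ⥤ ModuleCat.{v} k} (hF : IsLocFinDim k A F) (φ : F ⟶ G)
    (hφ : ∀ a, Function.Surjective (φ.app a)) : IsLocFinDim k A G where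
  additive := ⟨by
    intro a b f g
    ext x
    obtain ⟨x, rfl⟩ := hφ a x
    have := hF.additive
    simp only [ModuleCat.hom_add, LinearMap.add_apply]
    erw [← NatTrans.naturality_apply, ← NatTrans.naturality_apply, ← NatTrans.naturality_apply]
    simp⟩
  linear := ⟨by
    intro a b f r
    ext x
    obtain ⟨x, rfl⟩ := hφ a x
    have := hF.linear
    simp only [ModuleCat.hom_smul, LinearMap.smul_apply]
    erw [← NatTrans.naturality_apply, ← NatTrans.naturality_apply]
    simp⟩
  finite := fun a => by
    have := hF.finite a
    exact Module.Finite.of_surjective (φ.app a).hom (hφ a)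

instance : (locFinDim k A).IsClosedUnderSubobjects where
  prop_of_mono f _ hY :=
    IsLocFinDim.of_jointly_injective (J := Unit) (fun _ => hY) (fun _ => f) fun a _ _ h =>
      (ModuleCat.mono_iff_injective (f.app a)).1 inferInstance (h ())

instance : (locFinDim k A).IsClosedUnderQuotients where
  prop_of_epi f _ hX :=
    IsLocFinDim.of_surjective hX f fun a => (ModuleCat.epi_iff_surjective (f.app a)).1 inferInstance

instance : (locFinDim k A).IsClosedUnderFiniteProducts where
  isClosedUnderLimitsOfShape J _ := ⟨by
    rintro X ⟨p⟩
    refine IsLocFinDim.of_jointly_injective (fun j => p.prop_diag_obj ⟨j⟩)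
      (fun j => p.π.app ⟨j⟩) fun a x y h => ?_
    exact Concrete.isLimit_ext _ (isLimitOfPreserves ((evaluation _ _).obj a) p.isLimit) x y
      fun ⟨j⟩ => h j⟩

instance : (locFinDim k A).ContainsZero where
  exists_zero := by
    obtain ⟨Z, hZ⟩ := HasZeroObject.zero (C := A ⥤ ModuleCat.{v} k)
    refine ⟨Z, hZ, IsLocFinDim.of_jointly_injective (J := Empty) (G := fun _ => Z) nofun nofun
      fun a x y _ => ?_⟩
    have := ModuleCat.subsingleton_of_isZero (hZ.obj a)
    exact Subsingleton.elim _ _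

/-- By the instances above, `mod A` is abelian; in particular it has finite direct sums. -/
instance : HasFiniteBiproducts (LFDMod k A) := Abelian.hasFiniteBiproducts

end ModA

section ProjInj

variable (k : Type v) [Field k] {A : Type u} [Category.{v} A] [Preadditive A] [Linear k A]
  [IsSpectroid k A]

/-- The projective module `P_a = Hom_A(a, -)` at `a`. -/
def projAt (a : A) : LFDMod k A where
  obj := (linearCoyoneda k A).obj (Opposite.op a)
  property :=
    { additive := inferInstance
      linear := ⟨by
        intro b c f r
        ext x
        exact Linear.comp_smul _ _ _ _ _ _⟩
      finite := fun b => IsSpectroid.homFinite a b }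

/-- The injective module `I_a = D Hom_A(-, a)` at `a`, where `D = Hom_k(-, k)`. For `f : b ⟶ c`
the map `I_a(b) → I_a(c)` is the transpose of precomposition `Hom_A(c, a) → Hom_A(b, a)`. -/
def injAt (a : A) : LFDMod k A where
  obj :=
    { obj := fun b => ModuleCat.of k (Module.Dual k (b ⟶ a))
      map := fun f => ModuleCat.ofHom (Module.Dual.transpose (R := k) (Linear.leftComp k a f))
      map_id := fun b => by
        ext φ x
        simp [Module.Dual.transpose]
      map_comp := fun f g => by
        ext φ x
        simp [Module.Dual.transpose] }
  property :=
    { additive := ⟨by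
        intro b c f g
        ext φ x
        simp [Module.Dual.transpose]⟩
      linear := ⟨by
        intro b c f r
        ext φ x
        simp [Module.Dual.transpose]⟩
      finite := fun b => by
        have := IsSpectroid.homFinite (k := k) b a
        exact inferInstanceAs (Module.Finite k (Module.Dual k (b ⟶ a))) }

variable {k}

/-- `M` is finitely generated: there is an epimorphism from a finite direct sum of modules `P_a`
to `M`. -/
def FinGen (M : LFDMod k A) : Prop :=
  ∃ (r : ℕ) (a : Fin r → A) (p : (⨁ fun i => projAt k (a i)) ⟶ M), Epi p

/-- `M` is finitely presented: there is an epimorphism from a finite direct sum of modules `P_a`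
to `M` whose kernel is finitely generated. -/
def FinPres (M : LFDMod k A) : Prop :=
  ∃ (r : ℕ) (a : Fin r → A) (p : (⨁ fun i => projAt k (a i)) ⟶ M), Epi p ∧ FinGen (kernel p)

/-- `M` is finitely co-generated: there is a monomorphism from `M` to a finite direct sum of
modules `I_b`. -/
def FinCogen (M : LFDMod k A) : Prop :=
  ∃ (s : ℕ) (b : Fin s → A) (j : M ⟶ ⨁ fun i => injAt k (b i)), Mono j

/-- `M` is finitely co-presented: there is a monomorphism from `M` to a finite direct sum of
modules `I_b` whose cokernel is finitely co-generated. -/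
def FinCopres (M : LFDMod k A) : Prop :=
  ∃ (s : ℕ) (b : Fin s → A) (j : M ⟶ ⨁ fun i => injAt k (b i)), Mono j ∧ FinCogen (cokernel j)

end ProjInj

section AlmostSplit

variable {C : Type*} [Category* C]

/-- `g : E ⟶ N` is right almost split: it is not a retraction, and every morphism to `N` that is
not a retraction factors through `g`. -/
def IsRightAlmostSplit {E N : C} (g : E ⟶ N) : Prop :=
  ¬ IsSplitEpi g ∧ ∀ (X : C) (h : X ⟶ N), ¬ IsSplitEpi h → ∃ h' : X ⟶ E, h' ≫ g = h

/-- `f : L ⟶ E` is left almost split: it is not a section, and every morphism from `L` that is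
not a section factors through `f`. -/
def IsLeftAlmostSplit {L E : C} (f : L ⟶ E) : Prop :=
  ¬ IsSplitMono f ∧ ∀ (X : C) (h : L ⟶ X), ¬ IsSplitMono h → ∃ h' : E ⟶ X, f ≫ h' = h

/-- `0 ⟶ S.X₁ ⟶ S.X₂ ⟶ S.X₃ ⟶ 0` is an almost split sequence. -/
structure IsAlmostSplitSequence [HasZeroMorphisms C] (S : ShortComplex C) : Prop where
  shortExact : S.ShortExact
  left : IsLeftAlmostSplit S.f
  right : IsRightAlmostSplit S.g

end AlmostSplit

end LocFin

/-! The modules `P_a` and `I_a` are linked by a perfect pairing between `Hom(P_a, X)` and `Hom(X,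
I_a)`, both finite dimensional: these spaces are `X(a)` and its dual. `SerrePair` and `SerreFamily`
record this together with the fact that the `P_a` determine all morphisms. These axioms are
self-dual, with the roles of the `P_a` and the `I_a` exchanged, so statement (2) is statement (1) in
the opposite category.

Necessity needs only a right almost split `g : E ⟶ M`. If `M` is not finitely generated, each
finitely generated subobject is proper and its inclusion lifts through `g`. Finite dimensionality
lets a limit of these lifts be taken, which gives a section of `g` (`finGenBy_of_rightAlmostSplit`).
So `M` is a quotient of some finitely generated projective `P₀`. If `K` is the kernel, some finitely
generated `K' ⊆ K` is killed by exactly those morphisms `P₀ ⟶ E` that kill `K`. Were `P₀/K' ⟶ M` not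
split, it would lift through `g`, and the lift would descend to a section of `g`. Hence it splits,
`K/K'` is a quotient of `P₀`, and `K` is finitely generated
(`exists_generators_of_rightAlmostSplit`).

Sufficiency is the Auslander-Reiten construction (`exists_almostSplit`). A presentation `P₁ ⟶ P₀ ⟶
M` yields a Nakayama transform `νd : I₁ ⟶ I₀`. A functional on `Hom(P₀, M)` that vanishes on the
radical of `End M` but not on the identity yields `θ : M ⟶ I₀`. The pullback of `νd` along `θ` is
right almost split over `M`. Its kernel embeds in `I₁`, which permits cutting it down to an
indecomposable one (`exists_indecomposable_kernel`). By Fitting's lemma (`SerreFamily.localEnd`)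
that kernel has a local endomorphism ring, so the other end of the sequence is left almost split too
(`isLeftAlmostSplit_of_localEnd`). -/

namespace LocFin

/-! ### Linear opposite categories and Serre pairs -/

/-- The opposite of a `k`-linear category is `k`-linear. -/
instance linearOpposite {k : Type*} [Field k] {C : Type*} [Category* C] [Preadditive C]
    [Linear k C] : Linear k Cᵒᵖ where
  homModule _ _ :=
    { smul := fun r f => (r • f.unop).op
      one_smul := fun f => Quiver.Hom.unop_inj (one_smul k f.unop)
      mul_smul := fun r s f => Quiver.Hom.unop_inj (mul_smul r s f.unop)
      smul_zero := fun r => Quiver.Hom.unop_inj (smul_zero r)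
      smul_add := fun r f g => Quiver.Hom.unop_inj (smul_add r f.unop g.unop)
      add_smul := fun r s f => Quiver.Hom.unop_inj (add_smul r s f.unop)
      zero_smul := fun f => Quiver.Hom.unop_inj (zero_smul k f.unop) }
  smul_comp _ _ _ r f g := Quiver.Hom.unop_inj (Linear.comp_smul _ _ _ g.unop r f.unop)
  comp_smul _ _ _ f r g := Quiver.Hom.unop_inj (Linear.smul_comp _ _ _ r g.unop f.unop)

section Hom

variable (k : Type*) [Field k] {C : Type*} [Category* C] [Preadditive C] [Linear k C]

/-- Passage to the opposite category as a linear equivalence on morphisms. -/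
def opLinearEquiv (X Y : C) : (X ⟶ Y) ≃ₗ[k] (Opposite.op Y ⟶ Opposite.op X) where
  toFun f := f.op
  map_add' _ _ := rfl
  map_smul' _ _ := rfl
  invFun f := f.unop
  left_inv _ := rfl
  right_inv _ := rfl

end Hom

/-- A linear functional `t` on `Hom(P, I)` such that `(u, h) ↦ t (u ≫ h)` is a perfect pairing
of the finite dimensional spaces `Hom(P, X)` and `Hom(X, I)` for all `X`. In a module category,
`I` is then the Nakayama transform of the projective `P`. -/
structure SerrePair (k : Type*) [Field k] {C : Type*} [Category* C] [Preadditive C] [Linear k C]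
    (P I : C) where
  t : (P ⟶ I) →ₗ[k] k
  finite_left : ∀ X : C, Module.Finite k (P ⟶ X)
  finite_right : ∀ X : C, Module.Finite k (X ⟶ I)
  left_nondeg : ∀ {X : C} (u : P ⟶ X), (∀ h : X ⟶ I, t (u ≫ h) = 0) → u = 0
  right_nondeg : ∀ {X : C} (h : X ⟶ I), (∀ u : P ⟶ X, t (u ≫ h) = 0) → h = 0

namespace SerrePair

variable {k : Type*} [Field k] {C : Type*} [Category* C] [Preadditive C] [Linear k C]
  {P I : C}

/-- The dual Serre pair in the opposite category. -/
def op (S : SerrePair k P I) : SerrePair k (Opposite.op I) (Opposite.op P) where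
  t := S.t ∘ₗ (opLinearEquiv k P I).symm.toLinearMap
  finite_left X :=
    have := S.finite_right X.unop
    Module.Finite.equiv (opLinearEquiv k X.unop I)
  finite_right X :=
    have := S.finite_left X.unop
    Module.Finite.equiv (opLinearEquiv k P X.unop)
  left_nondeg u hu := Quiver.Hom.unop_inj (S.right_nondeg u.unop fun v => hu v.op)
  right_nondeg h hh := Quiver.Hom.unop_inj (S.left_nondeg h.unop fun v => hh v.op)

variable (S : SerrePair k P I)

/-- The map from `Hom(X, I)` to the dual of `Hom(P, X)` induced by the pairing. -/
def toDual (X : C) : (X ⟶ I) →ₗ[k] Module.Dual k (P ⟶ X) where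
  toFun h := S.t ∘ₗ Linear.rightComp k P h
  map_add' h h' := by ext u; simp
  map_smul' r h := by ext u; simp

lemma toDual_injective (X : C) : Function.Injective (S.toDual X) := by
  rw [injective_iff_map_eq_zero]
  exact fun h hh => S.right_nondeg h fun u => LinearMap.congr_fun hh u

lemma hom_ext_right {X : C} {h h' : X ⟶ I} (e : ∀ u : P ⟶ X, S.t (u ≫ h) = S.t (u ≫ h')) :
    h = h' :=
  S.toDual_injective X (LinearMap.ext e)

lemma hom_ext_left {X : C} {u u' : P ⟶ X} (e : ∀ h : X ⟶ I, S.t (u ≫ h) = S.t (u' ≫ h)) :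
    u = u' := by
  rw [← sub_eq_zero]
  exact S.left_nondeg _ fun h => by simp [e]

/-- Nondegeneracy on each side embeds each space in the dual of the other. Both are finite
dimensional, so the dimensions agree and the embeddings are bijective. -/
lemma exists_right {X : C} (φ : Module.Dual k (P ⟶ X)) :
    ∃ h : X ⟶ I, ∀ u, S.t (u ≫ h) = φ u := by
  have := S.finite_left X
  have := S.finite_right X
  have h1 : Module.finrank k (X ⟶ I) ≤ Module.finrank k (Module.Dual k (P ⟶ X)) :=
    LinearMap.finrank_le_finrank_of_injective (S.toDual_injective X)
  let ψ : (P ⟶ X) →ₗ[k] Module.Dual k (X ⟶ I) := (S.toDual X).flip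
  have hψ : Function.Injective ψ := by
    rw [injective_iff_map_eq_zero]
    exact fun u hu => S.left_nondeg u fun h => LinearMap.congr_fun hu h
  have h2 := LinearMap.finrank_le_finrank_of_injective hψ
  rw [Subspace.dual_finrank_eq] at h1 h2
  have h3 : Function.Surjective (S.toDual X) :=
    (LinearMap.injective_iff_surjective_of_finrank_eq_finrank
      (by rw [Subspace.dual_finrank_eq]; omega)).1 (S.toDual_injective X)
  obtain ⟨h, hh⟩ := h3 φ
  exact ⟨h, fun u => by rw [← hh]; rfl⟩

lemma exists_left {X : C} (φ : Module.Dual k (X ⟶ I)) :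
    ∃ u : P ⟶ X, ∀ h, S.t (u ≫ h) = φ h := by
  obtain ⟨u, hu⟩ := S.op.exists_right (X := Opposite.op X)
    (φ ∘ₗ (opLinearEquiv k X I).symm.toLinearMap)
  exact ⟨u.unop, fun h => hu h.op⟩

-- Precomposition with the epimorphism `f` is injective from `Hom(Y, I)` to `Hom(X, I)`. Under the
-- pairing its transpose is composition `Hom(P, X) → Hom(P, Y)`, which is therefore surjective.
include S in
lemma lift_of_epi {X Y : C} (f : X ⟶ Y) [Epi f] (u : P ⟶ Y) : ∃ u' : P ⟶ X, u' ≫ f = u := by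
  have hinj : Function.Injective (Linear.leftComp k I f) := fun a b h => by
    simpa [cancel_epi] using h
  obtain ⟨r, hr⟩ := LinearMap.exists_leftInverse_of_injective _ (LinearMap.ker_eq_bot.2 hinj)
  obtain ⟨u', hu'⟩ := S.exists_left (X := X) ((S.t ∘ₗ Linear.leftComp k I u) ∘ₗ r)
  refine ⟨u', S.hom_ext_left fun h => ?_⟩
  have := LinearMap.congr_fun hr h
  simp only [LinearMap.comp_apply, Linear.leftComp_apply, LinearMap.id_apply] at this
  simp [hu', this]

include S in
lemma projective : Projective P where
  factors u f _ := S.lift_of_epi f u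

variable {S} in
/-- The Nakayama transform of a morphism `d : P' ⟶ P`. -/
lemma exists_nakayama {P' I' : C} (S' : SerrePair k P' I') (d : P' ⟶ P) :
    ∃ e : I' ⟶ I, ∀ u : P ⟶ I', S.t (u ≫ e) = S'.t (d ≫ u) :=
  S.exists_right (S'.t ∘ₗ Linear.leftComp k I' d)

/-- Finite direct sums of Serre pairs. -/
noncomputable def biproduct [HasFiniteBiproducts C] {r : ℕ} {P I : Fin r → C}
    (S : ∀ i, SerrePair k (P i) (I i)) : SerrePair k (⨁ P) (⨁ I) where
  t := ∑ i, (S i).t ∘ₗ Linear.leftComp k _ (biproduct.ι P i) ∘ₗ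
    Linear.rightComp k _ (biproduct.π I i)
  finite_left X := by
    have := fun i => (S i).finite_left X
    exact Module.Finite.of_injective
      (LinearMap.pi fun i => Linear.leftComp k X (biproduct.ι P i)) fun a b h =>
        biproduct.hom_ext' _ _ fun i => congrFun h i
  finite_right X := by
    have := fun i => (S i).finite_right X
    exact Module.Finite.of_injective
      (LinearMap.pi fun i => Linear.rightComp k X (biproduct.π I i)) fun a b h =>
        biproduct.hom_ext _ _ fun i => congrFun h i
  left_nondeg u hu := biproduct.hom_ext' _ _ fun i => by
    rw [comp_zero]
    refine (S i).left_nondeg _ fun h => ?_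
    have := hu (h ≫ biproduct.ι I i)
    simp only [LinearMap.sum_apply, LinearMap.comp_apply, Linear.leftComp_apply,
      Linear.rightComp_apply, Category.assoc] at this
    rw [Finset.sum_eq_single i] at this
    · simpa using this
    · intro j _ hj
      simp [biproduct.ι_π_ne I (Ne.symm hj)]
    · simp
  right_nondeg h hh := biproduct.hom_ext _ _ fun i => by
    rw [zero_comp]
    refine (S i).right_nondeg _ fun u => ?_
    have := hh (biproduct.π P i ≫ u)
    simp only [LinearMap.sum_apply, LinearMap.comp_apply, Linear.leftComp_apply,
      Linear.rightComp_apply, Category.assoc] at this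
    rw [Finset.sum_eq_single i] at this
    · simpa using this
    · intro j _ hj
      simp [biproduct.ι_π_ne_assoc P hj]
    · simp

end SerrePair

/-! ### Serre families and their duality -/

/-- A family of Serre pairs `(P i, I i)` such that the `P i` are jointly separating and such that
morphisms `X ⟶ Y` amount to natural families of linear maps `Hom(P i, X) → Hom(P i, Y)`. -/
structure SerreFamily (k : Type*) [Field k] {C : Type*} [Category* C] [Preadditive C]
    [Linear k C] {ι : Type*} (P I : ι → C) where
  pair : ∀ i, SerrePair k (P i) (I i)
  separating : ∀ {X Y : C} (f : X ⟶ Y), (∀ i (u : P i ⟶ X), u ≫ f = 0) → f = 0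
  dense : ∀ {X Y : C} (η : ∀ i, (P i ⟶ X) →ₗ[k] (P i ⟶ Y)),
    (∀ i j (α : P j ⟶ P i) (u : P i ⟶ X), η j (α ≫ u) = α ≫ η i u) →
      ∃ f : X ⟶ Y, ∀ i (u : P i ⟶ X), η i u = u ≫ f

namespace SerreFamily

variable {k : Type*} [Field k] {C : Type*} [Category* C] [Preadditive C] [Linear k C]
  {ι : Type*} {P I : ι → C} (S : SerreFamily k P I)

include S in
lemma coseparating {X Y : C} (f : X ⟶ Y) (h : ∀ i (w : Y ⟶ I i), f ≫ w = 0) : f = 0 :=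
  S.separating f fun i u => (S.pair i).left_nondeg _ fun w => by simp [h]

-- The dual of `dense`, which makes the axioms self-dual. Each `η i` is transposed through the
-- pairing to a map `ζ i` on morphisms from `P i`. Naturality of `ζ` along `α : P j ⟶ P i` is
-- naturality of `η` along the Nakayama transform of `α`.
include S in
lemma codense {X Y : C} (η : ∀ i, (Y ⟶ I i) →ₗ[k] (X ⟶ I i))
    (hη : ∀ i j (β : I i ⟶ I j) (w : Y ⟶ I i), η j (w ≫ β) = η i w ≫ β) :
    ∃ f : X ⟶ Y, ∀ i (w : Y ⟶ I i), η i w = f ≫ w := by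
  choose ζ hζ using fun i (u : P i ⟶ X) =>
    (S.pair i).exists_left (((S.pair i).t ∘ₗ Linear.leftComp k _ u) ∘ₗ η i)
  simp only [LinearMap.comp_apply, Linear.leftComp_apply] at hζ
  obtain ⟨f, hf⟩ := S.dense (fun i =>
    { toFun := ζ i
      map_add' := fun u v => (S.pair i).hom_ext_left fun h => by simp [hζ]
      map_smul' := fun r u => (S.pair i).hom_ext_left fun h => by simp [hζ] })
    fun i j α u => (S.pair j).hom_ext_left fun w => by
      obtain ⟨β, hβ⟩ := (S.pair j).exists_nakayama (S := S.pair i) α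
      simp only [LinearMap.coe_mk, AddHom.coe_mk, Category.assoc]
      rw [hζ, ← hβ (ζ i u ≫ w), Category.assoc (ζ i u), hζ, hη, ← Category.assoc, hβ,
        Category.assoc]
  exact ⟨f, fun i w => (S.pair i).hom_ext_right fun u => by
    rw [← hζ, ← Category.assoc, ← hf]; rfl⟩

/-- The dual family in the opposite category. -/
def op : SerreFamily k (fun i => Opposite.op (I i)) (fun i => Opposite.op (P i)) where
  pair i := (S.pair i).op
  separating f h := Quiver.Hom.unop_inj
    (S.coseparating f.unop fun i w => congrArg Quiver.Hom.unop (h i w.op))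
  dense {X Y} η hη := by
    obtain ⟨f, hf⟩ := S.codense (X := Y.unop) (Y := X.unop)
      (fun i => (opLinearEquiv k Y.unop (I i)).symm.toLinearMap ∘ₗ η i ∘ₗ
        (opLinearEquiv k X.unop (I i)).toLinearMap)
      fun i j β w => congrArg Quiver.Hom.unop (hη i j β.op w.op)
    exact ⟨f.op, fun i u => Quiver.Hom.unop_inj (hf i u.unop)⟩

include S in
lemma epi_of_lift {X Y : C} (f : X ⟶ Y)
    (h : ∀ i (u : P i ⟶ Y), ∃ u' : P i ⟶ X, u' ≫ f = u) : Epi f :=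
  Preadditive.epi_of_cancel_zero f fun g hg => S.separating g fun i u => by
    obtain ⟨u', rfl⟩ := h i u
    simp [hg]

include S in
lemma mono_of_cancel {X Y : C} (f : X ⟶ Y)
    (h : ∀ i (u : P i ⟶ X), u ≫ f = 0 → u = 0) : Mono f :=
  Preadditive.mono_of_cancel_zero f fun g hg => S.separating g fun i u =>
    h i (u ≫ g) (by simp [hg])

end SerreFamily

/-! ### Fitting's lemma and local endomorphism rings -/

/-- The projection onto the Fitting-one component of an endomorphism is natural. -/
lemma exists_fitting_projection {k : Type*} [Field k] {ι : Type*} (V : ι → Type*)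
    [∀ i, AddCommGroup (V i)] [∀ i, Module k (V i)] [∀ i, Module.Finite k (V i)]
    (φ : ∀ i, V i →ₗ[k] V i) :
    ∃ e : ∀ i, V i →ₗ[k] V i,
      (∀ i j (T : V i →ₗ[k] V j), T ∘ₗ φ i = φ j ∘ₗ T → T ∘ₗ e i = e j ∘ₗ T) ∧
      (∀ i, e i ∘ₗ e i = e i) ∧
      (∀ i x, φ i x = 0 → e i x = 0) ∧ (∀ i x, φ i x = x → e i x = x) := by
  have hc := fun i => (φ i).isCompl_iSup_ker_pow_iInf_range_pow
  have ker_le : ∀ i x n, (φ i ^ n) x = 0 → x ∈ ⨆ n, LinearMap.ker (φ i ^ n) := fun i x n h =>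
    Submodule.mem_iSup_of_mem n h
  refine ⟨fun i => Submodule.projection _ _ (hc i).symm, fun i j T hT => ?_, fun i => ?_,
    fun i x hx => ?_, fun i x hx => ?_⟩
  -- A map intertwining `φ i` and `φ j` intertwines their powers. It thus respects both Fitting
  -- summands, which are built from kernels and ranges of powers, and so commutes with the
  -- projections.
  · have hT' : ∀ (n : ℕ) x, T ((φ i ^ n) x) = (φ j ^ n) (T x) := by
      intro n
      induction n with
      | zero => simp
      | succ n ih =>
        intro x
        rw [pow_succ', pow_succ', Module.End.mul_apply, Module.End.mul_apply, ← ih]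
        exact LinearMap.congr_fun hT _
    ext x
    obtain ⟨y, hy, z, hz, rfl⟩ : ∃ y ∈ ⨆ n, LinearMap.ker (φ i ^ n),
        ∃ z ∈ ⨅ n, LinearMap.range (φ i ^ n), y + z = x :=
      Submodule.mem_sup.1 ((hc i).sup_eq_top ▸ Submodule.mem_top)
    have hy' : T y ∈ ⨆ n, LinearMap.ker (φ j ^ n) := by
      have : (⨆ n, LinearMap.ker (φ i ^ n)) ≤ (⨆ n, LinearMap.ker (φ j ^ n)).comap T :=
        iSup_le fun n w hw => ker_le j _ n (by
          rw [← hT', LinearMap.mem_ker.1 hw, map_zero])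
      exact this hy
    have hz' : T z ∈ ⨅ n, LinearMap.range (φ j ^ n) := by
      rw [Submodule.mem_iInf] at hz ⊢
      intro n
      obtain ⟨w, rfl⟩ := hz n
      exact ⟨T w, (hT' n w).symm⟩
    simp only [LinearMap.comp_apply, map_add]
    rw [Submodule.projection_apply_of_mem_left _ hz, Submodule.projection_apply_of_mem_left _ hz',
      (Submodule.projection_apply_eq_zero_iff _).2 hy,
      (Submodule.projection_apply_eq_zero_iff _).2 hy', map_zero]
  · ext x
    exact Submodule.projection_apply_of_mem_left _ (Submodule.projection_apply_mem _ _)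
  · exact (Submodule.projection_apply_eq_zero_iff _).2 (ker_le i x 1 (by simpa using hx))
  · refine Submodule.projection_apply_of_mem_left _ (Submodule.mem_iInf _ |>.2 fun n => ⟨x, ?_⟩)
    induction n with
    | zero => simp
    | succ n ih => rw [pow_succ', Module.End.mul_apply, ih, hx]

section Indecomposable

variable {C : Type*} [Category* C] [Abelian C]

/-- An idempotent `e` splits `M` as `kernel e ⊞ kernel (𝟙 M - e)`. -/
lemma Indecomposable.eq_zero_or_eq_id {M : C} (hM : Indecomposable M) (e : M ⟶ M)
    (he : e ≫ e = e) : e = 0 ∨ e = 𝟙 M := by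
  have h0 : (𝟙 M - e) ≫ e = 0 := by simp [he]
  have h1 : e ≫ (𝟙 M - e) = 0 := by simp [he]
  let a := kernel.lift e (𝟙 M - e) h0
  let b := kernel.lift (𝟙 M - e) e h1
  have k0 : kernel.ι e ≫ e = 0 := kernel.condition e
  have k1 : kernel.ι (𝟙 M - e) ≫ e = kernel.ι (𝟙 M - e) := by
    have := kernel.condition (𝟙 M - e)
    rw [Preadditive.comp_sub, Category.comp_id, sub_eq_zero] at this
    exact this.symm
  let iso : M ≅ kernel e ⊞ kernel (𝟙 M - e) :=
    { hom := biprod.lift a b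
      inv := biprod.desc (kernel.ι _) (kernel.ι _)
      hom_inv_id := by simp [biprod.lift_desc, a, b]
      inv_hom_id := by
        ext <;> simp [a, b, k0, k1] }
  rcases hM.2 _ _ iso with h | h
  · right
    have : (𝟙 M - e) = a ≫ kernel.ι e := by simp [a]
    rw [h.eq_of_src (kernel.ι e) 0, comp_zero, sub_eq_zero] at this
    exact this.symm
  · left
    have : e = b ≫ kernel.ι (𝟙 M - e) := by simp [b]
    rwa [h.eq_of_src (kernel.ι (𝟙 M - e)) 0, comp_zero] at this

lemma Indecomposable.op {M : C} (hM : Indecomposable M) : Indecomposable (Opposite.op M) := by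
  refine ⟨fun h => hM.1 h.unop, fun Y Z e => ?_⟩
  let iso : M ≅ Y.unop ⊞ Z.unop :=
    { hom := biprod.lift (biprod.inl ≫ e.inv).unop (biprod.inr ≫ e.inv).unop
      inv := biprod.desc (e.hom ≫ biprod.fst).unop (e.hom ≫ biprod.snd).unop
      hom_inv_id := by
        rw [biprod.lift_desc]
        apply Quiver.Hom.op_inj
        simp only [op_add, op_comp, Quiver.Hom.op_unop, op_id]
        rw [Category.assoc, Category.assoc, ← Preadditive.comp_add, ← Category.assoc biprod.fst,
          ← Category.assoc biprod.snd, ← Preadditive.add_comp, biprod.total]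
        simp
      inv_hom_id := by
        ext <;> apply Quiver.Hom.op_inj <;> simp }
  rcases hM.2 _ _ iso with h | h
  · exact Or.inl h.op
  · exact Or.inr h.op

end Indecomposable

/-- Every endomorphism `φ` is invertible or has `1 - φ` invertible. -/
def LocalEnd {C : Type*} [Category* C] [Preadditive C] (M : C) : Prop :=
  ¬ IsZero M ∧ ∀ φ : M ⟶ M, IsIso φ ∨ IsIso (𝟙 M - φ)

namespace LocalEnd

variable {C : Type*} [Category* C] [Preadditive C] {M : C} (hM : LocalEnd M)

-- The point is that one-sided inverses are two-sided. If `a ≫ b = 𝟙 M`, then `b ≫ a` is idempotent: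
-- when it is invertible it is the identity, and when its complement is invertible `b = 0`, so `M`
-- would be zero.
include hM in
lemma isIso_of_isIso_comp (φ ψ : M ⟶ M) (h : IsIso (φ ≫ ψ)) : IsIso φ ∧ IsIso ψ := by
  have key : ∀ a b : M ⟶ M, a ≫ b = 𝟙 M → b ≫ a = 𝟙 M := by
    intro a b hab
    rcases hM.2 (b ≫ a) with h | h
    · have hi : (b ≫ a) ≫ (b ≫ a) = (b ≫ a) ≫ 𝟙 M := by
        rw [Category.assoc, ← Category.assoc a, hab, Category.id_comp, Category.comp_id]
      exact (cancel_epi (b ≫ a)).1 hi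
    · exfalso
      have hi : (𝟙 M - b ≫ a) ≫ b = 0 := by simp [hab]
      have hb : b = 0 := by
        rw [← cancel_epi (𝟙 M - b ≫ a), hi, comp_zero]
      rw [hb, comp_zero] at hab
      exact hM.1 ((IsZero.iff_id_eq_zero M).2 hab.symm)
  have h1 : φ ≫ (ψ ≫ inv (φ ≫ ψ)) = 𝟙 M := by rw [← Category.assoc, IsIso.hom_inv_id]
  have h2 : (inv (φ ≫ ψ) ≫ φ) ≫ ψ = 𝟙 M := by rw [Category.assoc, IsIso.inv_hom_id]
  exact ⟨⟨_, h1, key _ _ h1⟩, ⟨_, key _ _ h2, h2⟩⟩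

include hM in
lemma isIso_or_isIso_of_add (φ ψ : M ⟶ M) (h : IsIso (φ + ψ)) : IsIso φ ∨ IsIso ψ := by
  have e : 𝟙 M - φ ≫ inv (φ + ψ) = ψ ≫ inv (φ + ψ) := by
    rw [sub_eq_iff_eq_add, add_comm, ← Preadditive.add_comp, IsIso.hom_inv_id]
  rcases hM.2 (φ ≫ inv (φ + ψ)) with h | h
  · exact Or.inl (hM.isIso_of_isIso_comp _ _ h).1
  · exact Or.inr (hM.isIso_of_isIso_comp _ _ (e ▸ h)).1

/-- The non-invertible endomorphisms of an object with local endomorphism ring. -/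
def radical (k : Type*) [Field k] [Linear k C] (hM : LocalEnd M) : Submodule k (M ⟶ M) where
  carrier := {φ | ¬ IsIso φ}
  zero_mem' := fun h => hM.1 ((IsZero.iff_id_eq_zero M).2 (by
    have : IsIso (0 : M ⟶ M) := h
    rw [← cancel_epi (0 : M ⟶ M), zero_comp, zero_comp]))
  add_mem' := fun ha hb h => (hM.isIso_or_isIso_of_add _ _ h).elim ha hb
  smul_mem' := fun r φ hφ h => hφ (by
    have : IsIso (φ ≫ (r • 𝟙 M)) := by simpa using h
    exact (hM.isIso_of_isIso_comp _ _ this).1)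

end LocalEnd

/-- The spaces `Hom(P i, M)` are finite dimensional, so `φ` has a Fitting decomposition on each of
them. By naturality the projections assemble to an idempotent `ε` of `M`, which is `0` or `𝟙 M`.
Accordingly `𝟙 M - φ` or `φ` is injective on every `Hom(P i, M)`, hence bijective there, hence
invertible. -/
lemma SerreFamily.localEnd {k : Type*} [Field k] {C : Type*} [Category* C] [Abelian C] [Linear k C]
    {ι : Type*} {P I : ι → C} (S : SerreFamily k P I) {M : C} (hM : Indecomposable M) :
    LocalEnd M := by
  refine ⟨hM.1, fun φ => ?_⟩
  have := fun i => (S.pair i).finite_left M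
  obtain ⟨e, h1, h2, h3, h4⟩ := exists_fitting_projection (k := k) (fun i => P i ⟶ M)
    (fun i => Linear.rightComp k (P i) φ)
  obtain ⟨ε, hε⟩ := S.dense e fun i j α u =>
    (LinearMap.congr_fun (h1 i j (Linear.leftComp k M α) (by ext; simp)) u).symm
  have hεε : ε ≫ ε = ε := by
    rw [← sub_eq_zero]
    refine S.separating _ fun i u => ?_
    have := LinearMap.congr_fun (h2 i) u
    rw [LinearMap.comp_apply, hε, hε] at this
    simpa [sub_eq_zero] using this
  have iso_of : ∀ ψ : M ⟶ M, (∀ i (u : P i ⟶ M), u ≫ ψ = 0 → u = 0) → IsIso ψ := by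
    intro ψ hψ
    have hm : Mono ψ := S.mono_of_cancel ψ hψ
    have he : Epi ψ := S.epi_of_lift ψ fun i u =>
      LinearMap.surjective_of_injective (f := Linear.rightComp k (P i) ψ)
        ((injective_iff_map_eq_zero _).2 (hψ i)) u
    exact isIso_of_mono_of_epi ψ
  rcases Indecomposable.eq_zero_or_eq_id hM ε hεε with h | h
  · right
    refine iso_of _ fun i u hu => ?_
    have hu' : u ≫ φ = u := by
      rw [Preadditive.comp_sub, Category.comp_id, sub_eq_zero] at hu
      exact hu.symm
    rw [← h4 i u hu', hε, h, comp_zero]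
  · left
    refine iso_of _ fun i u hu => ?_
    have := h3 i u hu
    rwa [hε, h, Category.comp_id] at this

/-! ### Almost split morphisms force finite presentation -/

/-- A linear extension of the functional sending an eventually constant function to its eventual
value. -/
lemma exists_linear_limit (k : Type*) [Field k] {D : Type*} (l : Filter D) [l.NeBot] :
    ∃ Λ : (D → k) →ₗ[k] k, ∀ (x : D → k) (c : k), (∀ᶠ d in l, x d = c) → Λ x = c := by
  let N : Submodule k (D → k) :=
    { carrier := {x | ∀ᶠ d in l, x d = 0}
      zero_mem' := Filter.Eventually.of_forall fun _ => rfl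
      add_mem' := fun ha hb => by
        filter_upwards [ha, hb] with d h1 h2
        simp [h1, h2]
      smul_mem' := fun r x hx => by
        filter_upwards [hx] with d h
        simp [h] }
  -- Since the filter is proper, the constant function `1` is not eventually zero. Some functional
  -- vanishes on `N` but not at `1`, and rescaling it gives `Λ`.
  have h1 : (fun _ => 1 : D → k) ∉ N := fun h => by
    obtain ⟨d, hd⟩ := Filter.Eventually.exists (f := l) h
    exact one_ne_zero hd
  obtain ⟨f, hf, hN⟩ := Submodule.exists_le_ker_of_notMem h1
  refine ⟨(f fun _ => 1)⁻¹ • f, fun x c hx => ?_⟩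
  have hmem : x - c • (fun _ => 1 : D → k) ∈ N := by
    change ∀ᶠ d in l, _
    filter_upwards [hx] with d h
    simp [h]
  have := LinearMap.mem_ker.1 (hN hmem)
  rw [map_sub, map_smul, sub_eq_zero] at this
  rw [LinearMap.smul_apply, this, smul_eq_mul, smul_eq_mul, mul_comm c, ← mul_assoc,
    inv_mul_cancel₀ hf, one_mul]

section FinGenBy

variable {C : Type*} [Category* C] [Preadditive C] {ι : Type*} (P : ι → C)

/-- There is a finite jointly epimorphic family of morphisms `P i ⟶ X`. -/
def FinGenBy (X : C) : Prop :=
  ∃ (r : ℕ) (a : Fin r → ι) (u : ∀ i, P (a i) ⟶ X), ∀ ⦃Z : C⦄ (h : X ⟶ Z),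
    (∀ i, u i ≫ h = 0) → h = 0

variable {P}

lemma FinGenBy.of_finite {X : C} {J : Type*} [Finite J] (a : J → ι) (u : ∀ i, P (a i) ⟶ X)
    (hu : ∀ ⦃Z : C⦄ (h : X ⟶ Z), (∀ i, u i ≫ h = 0) → h = 0) : FinGenBy P X := by
  obtain ⟨r, ⟨e⟩⟩ := Finite.exists_equiv_fin J
  exact ⟨r, fun i => a (e.symm i), fun i => u (e.symm i), fun Z h hh =>
    hu h (e.symm.surjective.forall.2 hh)⟩

lemma finGenBy_iff_exists_epi [HasFiniteBiproducts C] {X : C} : FinGenBy P X ↔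
    ∃ (r : ℕ) (a : Fin r → ι) (p : (⨁ fun i => P (a i)) ⟶ X), Epi p := by
  refine ⟨fun ⟨r, a, u, hu⟩ => ⟨r, a, biproduct.desc u, ?_⟩, fun ⟨r, a, p, hp⟩ =>
    ⟨r, a, fun i => biproduct.ι (fun i => P (a i)) i ≫ p, fun Z h hh => ?_⟩⟩
  · refine Preadditive.epi_of_cancel_zero _ fun h hh => hu h fun i => ?_
    rw [← biproduct.ι_desc u i, Category.assoc, hh, comp_zero]
  · refine Preadditive.epi_iff_cancel_zero p |>.1 hp _ h (biproduct.hom_ext' _ _ fun i => ?_)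
    rw [← Category.assoc, hh i, comp_zero]

end FinGenBy

/-- A subobject containing finitely many given elements. -/
lemma exists_mono_of_finset {C : Type*} [Category* C] [Abelian C] {ι : Type*} {P : ι → C} {M : C}
    (d : Finset (Σ i, P i ⟶ M)) :
    ∃ (N : C) (j : N ⟶ M), Mono j ∧ (∀ x ∈ d, ∃ v : P x.1 ⟶ N, v ≫ j = x.2) ∧
      (Epi j → FinGenBy P M) := by
  have := Abelian.hasFiniteBiproducts (C := C)
  let p : (⨁ fun x : d => P x.1.1) ⟶ M := biproduct.desc fun x => x.1.2
  refine ⟨_, image.ι p, inferInstance, fun x hx =>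
    ⟨biproduct.ι (fun x : d => P x.1.1) ⟨x, hx⟩ ≫ factorThruImage p, by simp [p]⟩, fun he => ?_⟩
  have hp : Epi p := by
    rw [← image.fac p]
    exact epi_comp _ _
  refine FinGenBy.of_finite (J := d) (fun x => x.1.1) (fun x => x.1.2) fun Z h hh => ?_
  rw [← cancel_epi p, comp_zero]
  exact biproduct.hom_ext' _ _ fun x => by simpa [p] using hh x

namespace SerreFamily

variable {k : Type*} [Field k] {C : Type*} [Category* C] [Abelian C] [Linear k C]
  {ι : Type*} {P I : ι → C} (S : SerreFamily k P I)

include S in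
/-- The target of a right almost split morphism is finitely generated. -/
lemma finGenBy_of_rightAlmostSplit {E M : C} {g : E ⟶ M} (hg : IsRightAlmostSplit g) :
    FinGenBy P M := by
  classical
  by_contra hM
  -- If `j` were a split epimorphism, the finite set `d` would generate `M`.
  have hlift : ∀ d : Finset (Σ i, P i ⟶ M), ∃ (N : C) (j : N ⟶ M) (h : N ⟶ E), Mono j ∧
      h ≫ g = j ∧ ∀ x ∈ d, ∃ v : P x.1 ⟶ N, v ≫ j = x.2 := by
    intro d
    obtain ⟨N, j, hj, hd, he⟩ := exists_mono_of_finset d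
    obtain ⟨h, hh⟩ := hg.2 N j fun hs => hM (he inferInstance)
    exact ⟨N, j, h, hj, hh, hd⟩
  choose N j h hj hh hd using hlift
  -- The functional that the partial lift `h d` assigns to `u`, once `u` factors through `N d`. The
  -- value `0` otherwise is harmless, because every `u` factors for all large `d`.
  let s : ∀ (d : Finset (Σ i, P i ⟶ M)) i, (P i ⟶ M) → Module.Dual k (E ⟶ I i) := fun d i u =>
    if hu : ∃ v : P i ⟶ N d, v ≫ j d = u then
      (S.pair i).t ∘ₗ Linear.leftComp k _ (hu.choose ≫ h d) else 0
  have hs : ∀ d i (v : P i ⟶ N d) w, s d i (v ≫ j d) w = (S.pair i).t (v ≫ h d ≫ w) := by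
    intro d i v w
    have hex : ∃ v' : P i ⟶ N d, v' ≫ j d = v ≫ j d := ⟨v, rfl⟩
    have hv : hex.choose = v := by
      have := hj d
      exact (cancel_mono (j d)).1 hex.choose_spec
    simp only [s, dif_pos hex, LinearMap.comp_apply, Linear.leftComp_apply, hv, Category.assoc]
  obtain ⟨Λ, hΛ⟩ := exists_linear_limit k (Filter.atTop : Filter (Finset (Σ i, P i ⟶ M)))
  have hmem : ∀ i (u : P i ⟶ M), ∀ᶠ d in Filter.atTop, ∃ v : P i ⟶ N d, v ≫ j d = u := by
    intro i u
    filter_upwards [Filter.eventually_ge_atTop {(⟨i, u⟩ : Σ i, P i ⟶ M)}] with d h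
    exact hd d ⟨i, u⟩ (h (Finset.mem_singleton_self _))
  have hΛ' : ∀ x y : Finset (Σ i, P i ⟶ M) → k, (∀ᶠ d in Filter.atTop, x d = y d) →
      Λ x = Λ y := by
    intro x y hxy
    rw [← sub_eq_zero, ← map_sub]
    refine hΛ _ _ ?_
    filter_upwards [hxy] with d h
    simp [h]
  -- The lifts `h d` need not be compatible, so `Λ` takes a limit of their functionals. The perfect
  -- pairing turns the limit back into a morphism `P i ⟶ E`. Linearity and naturality hold for all
  -- large `d`, hence in the limit.
  choose ζ hζ using fun i (u : P i ⟶ M) =>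
    (S.pair i).exists_left (Λ ∘ₗ LinearMap.pi fun d => s d i u)
  replace hζ : ∀ i u w, (S.pair i).t (ζ i u ≫ w) = Λ fun d => s d i u w := hζ
  obtain ⟨f, hf⟩ := S.dense (fun i =>
    { toFun := ζ i
      map_add' := fun u v => (S.pair i).hom_ext_left fun w => by
        rw [Preadditive.add_comp, map_add, hζ, hζ, hζ, ← map_add]
        refine hΛ' _ _ ?_
        filter_upwards [hmem i u, hmem i v] with d ⟨u', hu⟩ ⟨v', hv⟩
        rw [← hu, ← hv, ← Preadditive.add_comp, hs]
        simp [hs]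
      map_smul' := fun r u => (S.pair i).hom_ext_left fun w => by
        rw [Linear.smul_comp, map_smul, hζ, hζ, ← map_smul]
        refine hΛ' _ _ ?_
        filter_upwards [hmem i u] with d ⟨u', hu⟩
        rw [← hu, RingHom.id_apply, ← Linear.smul_comp, hs]
        simp [hs] })
    fun i j' α u => (S.pair j').hom_ext_left fun w => by
      obtain ⟨β, hβ⟩ := (S.pair j').exists_nakayama (S := S.pair i) α
      simp only [LinearMap.coe_mk, AddHom.coe_mk]
      rw [Category.assoc, ← hβ (ζ i u ≫ w), Category.assoc, hζ, hζ]
      refine hΛ' _ _ ?_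
      filter_upwards [hmem i u] with d ⟨u', hu⟩
      rw [← hu, ← Category.assoc, hs, hs, Category.assoc, ← hβ]
      simp
  refine hg.1 ⟨⟨f, ?_⟩⟩
  rw [← sub_eq_zero]
  refine S.separating _ fun i u => (S.pair i).left_nondeg _ fun w => ?_
  have hfu : ζ i u = u ≫ f := hf i u
  -- After composition with `g` the choice of lift disappears: the value is `t (u ≫ w)` for all
  -- large `d`.
  have hlim : Λ (fun d => s d i u (g ≫ w)) = (S.pair i).t (u ≫ w) := by
    refine hΛ _ _ ?_
    filter_upwards [hmem i u] with d ⟨u', hu⟩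
    rw [← hu, hs, ← Category.assoc (h d), hh, Category.assoc]
  rw [← hζ, hfu] at hlim
  simp only [Category.assoc] at hlim
  simp [hlim]

include S in
/-- If `g` is right almost split, then the kernel of any epimorphism onto its target from a
projective object of a Serre pair is finitely generated up to that projective object. -/
lemma exists_generators_of_rightAlmostSplit {E M P₀ I₀ K : C} {g : E ⟶ M}
    (hg : IsRightAlmostSplit g) (S₀ : SerrePair k P₀ I₀) (κ : K ⟶ P₀) (p : P₀ ⟶ M) (w : κ ≫ p = 0)
    (hS : (ShortComplex.mk κ p w).ShortExact) (h₀ : FinGenBy P P₀) : FinGenBy P K := by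
  classical
  have : Mono κ := hS.mono_f
  have : Epi p := hS.epi_g
  have := S₀.finite_left E
  let ann : Finset (Σ i, P i ⟶ K) → Submodule k (P₀ ⟶ E) := fun d =>
    ⨅ x ∈ d, LinearMap.ker (Linear.leftComp k E (x.2 ≫ κ))
  have mem_ann : ∀ d s, s ∈ ann d ↔ ∀ x ∈ d, (x.2 ≫ κ) ≫ s = 0 := by
    intro d s
    simp [ann, Submodule.mem_iInf]
  -- With the annihilator of minimal dimension, adding one more element to `d` cannot shrink it. So
  -- whatever kills `d` kills all of `K`.
  obtain ⟨d, hd⟩ : ∃ d, ∀ d', Module.finrank k (ann d) ≤ Module.finrank k (ann d') := by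
    let n := sInf (Set.range fun d => Module.finrank k (ann d))
    obtain ⟨d, hd⟩ : n ∈ Set.range fun d => Module.finrank k (ann d) :=
      Nat.sInf_mem (Set.range_nonempty _)
    exact ⟨d, fun d' => hd.le.trans (Nat.sInf_le ⟨d', rfl⟩)⟩
  have hann : ∀ s ∈ ann d, κ ≫ s = 0 := by
    intro s hs
    refine S.separating _ fun i u => ?_
    have hle : ann (insert ⟨i, u⟩ d) ≤ ann d := fun s hs => by
      rw [mem_ann] at hs ⊢
      exact fun x hx => hs x (Finset.mem_insert_of_mem hx)
    rw [← Submodule.eq_of_le_of_finrank_le hle (hd _), mem_ann] at hs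
    simpa using hs ⟨i, u⟩ (Finset.mem_insert_self _ _)
  have := Abelian.hasFiniteBiproducts (C := C)
  let δ : (⨁ fun x : d => P x.1.1) ⟶ K := biproduct.desc fun x => x.1.2
  let π := cokernel.π (δ ≫ κ)
  have hπ0 : δ ≫ κ ≫ π = 0 := by rw [← Category.assoc]; exact cokernel.condition _
  let q : cokernel (δ ≫ κ) ⟶ M := cokernel.desc _ p (by simp [w])
  have hq : π ≫ q = p := cokernel.π_desc _ _ _
  -- Otherwise `q` lifts to `l` with `l ≫ g = q`. Then `π ≫ l` kills `d`, hence `K`, and descends to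
  -- a section of `g`.
  have hsplit : IsSplitEpi q := by
    by_contra hns
    obtain ⟨l, hl⟩ := hg.2 _ q hns
    have hκ : κ ≫ π ≫ l = 0 := hann _ ((mem_ann _ _).2 fun x hx => by
      have := congrArg (fun z => biproduct.ι (fun x : d => P x.1.1) ⟨x, hx⟩ ≫ z) hπ0
      simp only [δ, biproduct.ι_desc_assoc, comp_zero] at this
      rw [Category.assoc, reassoc_of% this, zero_comp])
    obtain ⟨σ, hσ⟩ : ∃ σ : M ⟶ E, p ≫ σ = π ≫ l :=
      ⟨hS.exact.desc _ hκ, hS.exact.g_desc _ hκ⟩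
    refine hg.1 ⟨⟨σ, ?_⟩⟩
    rw [← cancel_epi p, ← Category.assoc, hσ, Category.assoc, hl, hq, Category.comp_id]
  obtain ⟨⟨σ, hσ⟩⟩ := hsplit
  -- Here `𝟙 - q ≫ σ` projects `P₀/K'` onto `K/K'`, with `K'` the image of `δ ≫ κ`. Projectivity of
  -- `P₀` lifts this projection to `γ`, which lands in `K`.
  obtain ⟨γ, hγ⟩ := S₀.lift_of_epi π (π ≫ (𝟙 _ - q ≫ σ))
  have hγp : γ ≫ p = 0 := by
    rw [← hq, ← Category.assoc, hγ]
    simp [hσ]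
  obtain ⟨γ', hγ'⟩ : ∃ γ' : P₀ ⟶ K, γ' ≫ κ = γ := ⟨hS.exact.lift _ hγp, hS.exact.lift_f _ hγp⟩
  -- On `K` the projection acts as the identity modulo `K'`, so `𝟙 K - κ ≫ γ'` takes values in `K'`.
  -- Thus `K` is generated by the images of `δ` and `γ'`.
  have gen : ∀ ⦃Z : C⦄ (h : K ⟶ Z), δ ≫ h = 0 → γ' ≫ h = 0 → h = 0 := by
    intro Z h h1 h2
    have h3 : (𝟙 K - κ ≫ γ') ≫ κ ≫ π = 0 := by
      have h4 : κ ≫ π ≫ q = 0 := by rw [hq, w]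
      simp only [Preadditive.sub_comp, Category.id_comp, Category.assoc]
      rw [reassoc_of% hγ', hγ]
      simp only [Preadditive.comp_sub, Category.comp_id, reassoc_of% h4]
      simp
    let T := ShortComplex.mk (δ ≫ κ) π (cokernel.condition _)
    have hT : T.Exact := ShortComplex.exact_of_g_is_cokernel _ (cokernelIsCokernel _)
    refine S.separating _ fun i u => ?_
    obtain ⟨A, ρ, hρ, x, hx⟩ := hT.exact_up_to_refinements (u ≫ (𝟙 K - κ ≫ γ') ≫ κ)
      (by
        change (u ≫ (𝟙 K - κ ≫ γ') ≫ κ) ≫ π = 0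
        rw [Category.assoc, Category.assoc, h3, comp_zero])
    have hx' : ρ ≫ u ≫ (𝟙 K - κ ≫ γ') = x ≫ δ := by
      rw [← cancel_mono κ]
      simpa [T] using hx
    rw [← cancel_epi ρ, comp_zero]
    have := congrArg (· ≫ h) hx'
    simpa [h1, h2] using this
  obtain ⟨r, a, u, hu⟩ := h₀
  refine FinGenBy.of_finite (J := Fin r ⊕ d) (Sum.elim a fun x => x.1.1)
    (Sum.rec (fun i => u i ≫ γ') fun x => x.1.2) fun Z h hh => gen h ?_ ?_
  · exact biproduct.hom_ext' _ _ fun x => by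
      rw [biproduct.ι_desc_assoc, comp_zero]
      exact hh (Sum.inr x)
  · exact hu _ fun i => by
      rw [← Category.assoc]
      exact hh (Sum.inl i)

end SerreFamily

/-! ### Pushouts of extensions and left almost split morphisms -/

section Pushout

variable {C : Type*} [Category* C] [Abelian C]

/-- The pushout of a short exact sequence; it splits iff `u` extends along `f`. -/
lemma exists_pushout_shortExact {L E M X : C} {f : L ⟶ E} {g : E ⟶ M} {w : f ≫ g = 0}
    (hS : (ShortComplex.mk f g w).ShortExact) (u : L ⟶ X) :
    ∃ (E' : C) (i : X ⟶ E') (e : E ⟶ E') (g' : E' ⟶ M) (w' : i ≫ g' = 0),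
      (ShortComplex.mk i g' w').ShortExact ∧ f ≫ e = u ≫ i ∧ e ≫ g' = g ∧
      (IsSplitEpi g' → ∃ r : E ⟶ X, f ≫ r = u) := by
  have : Mono f := hS.mono_f
  have : Epi g := hS.epi_g
  let g' : pushout f u ⟶ M := pushout.desc g 0 (by simp [w])
  have hg' : pushout.inl f u ≫ g' = g := pushout.inl_desc _ _ _
  have w' : pushout.inr f u ≫ g' = 0 := pushout.inr_desc _ _ _
  have hepi : Epi g' := by
    have : Epi (pushout.inl f u ≫ g') := hg' ▸ inferInstance
    exact epi_of_epi (pushout.inl f u) g'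
  have hcol : IsColimit (CokernelCofork.ofπ g' w') := by
    refine CokernelCofork.IsColimit.ofπ' g' w' fun {Z} h hh => ?_
    have h0 : f ≫ pushout.inl f u ≫ h = 0 := by
      rw [← Category.assoc, pushout.condition, Category.assoc, hh, comp_zero]
    refine ⟨hS.exact.desc _ h0, pushout.hom_ext ?_ ?_⟩
    · rw [← Category.assoc, hg']
      exact hS.exact.g_desc _ h0
    · rw [← Category.assoc, w', zero_comp, hh]
  have hS' : (ShortComplex.mk (pushout.inr f u) g' w').ShortExact :=
    ShortComplex.ShortExact.mk' (ShortComplex.exact_of_g_is_cokernel _ hcol) inferInstance hepi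
  refine ⟨_, _, _, g', w', hS', pushout.condition, hg', fun ⟨⟨σ, hσ⟩⟩ => ?_⟩
  have h1 : (𝟙 _ - g' ≫ σ) ≫ g' = 0 := by simp [hσ]
  let r := hS'.exact.lift _ h1
  have hr : r ≫ pushout.inr f u = 𝟙 _ - g' ≫ σ := hS'.exact.lift_f _ h1
  refine ⟨pushout.inl f u ≫ r, ?_⟩
  rw [← cancel_mono (pushout.inr f u), Category.assoc, Category.assoc, hr, Preadditive.comp_sub,
    Category.comp_id, reassoc_of% hg', Preadditive.comp_sub, reassoc_of% w, pushout.condition]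
  simp

lemma isSplitEpi_of_isSplitMono {L E M : C} {f : L ⟶ E} {g : E ⟶ M} {w : f ≫ g = 0}
    (hS : (ShortComplex.mk f g w).ShortExact) (hf : IsSplitMono f) : IsSplitEpi g := by
  obtain ⟨⟨r, hr⟩⟩ := hf
  have : Epi g := hS.epi_g
  have h1 : f ≫ (𝟙 E - r ≫ f) = 0 := by simp [reassoc_of% hr]
  refine ⟨⟨hS.exact.desc _ h1, ?_⟩⟩
  have h2 : g ≫ hS.exact.desc _ h1 = 𝟙 E - r ≫ f := hS.exact.g_desc _ h1
  rw [← cancel_epi g, reassoc_of% h2, Category.comp_id]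
  simp [w]

/-- If `u` does not extend along `f`, the pushout sequence along `u` does not split, so its
epimorphism lifts through `g`. Comparing the two sequences gives `y : X ⟶ L` and `a : E ⟶ L` with `u
≫ y + f ≫ a = 𝟙 L`. Locality makes one summand invertible, so `f` or `u` is a section. -/
lemma isLeftAlmostSplit_of_localEnd {L E M : C} {f : L ⟶ E} {g : E ⟶ M} {w : f ≫ g = 0}
    (hS : (ShortComplex.mk f g w).ShortExact) (hg : IsRightAlmostSplit g) (hL : LocalEnd L) :
    IsLeftAlmostSplit f := by
  have : Mono f := hS.mono_f
  have hf : ¬ IsSplitMono f := fun h => hg.1 (isSplitEpi_of_isSplitMono hS h)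
  refine ⟨hf, fun X u hu => ?_⟩
  obtain ⟨E', i, e, g', w', hS', h1, h2, h3⟩ := exists_pushout_shortExact hS u
  by_cases hg' : IsSplitEpi g'
  · exact h3 hg'
  · exfalso
    obtain ⟨v, hv⟩ := hg.2 _ g' hg'
    have h4 : (𝟙 E - e ≫ v) ≫ g = 0 := by simp [hv, h2]
    have h5 : (i ≫ v) ≫ g = 0 := by simp [hv, w']
    obtain ⟨a, ha⟩ : ∃ a, a ≫ f = 𝟙 E - e ≫ v := ⟨hS.exact.lift _ h4, hS.exact.lift_f _ h4⟩
    obtain ⟨y, hy⟩ : ∃ y, y ≫ f = i ≫ v := ⟨hS.exact.lift _ h5, hS.exact.lift_f _ h5⟩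
    have h6 : u ≫ y = 𝟙 L - f ≫ a := by
      rw [← cancel_mono f, Category.assoc, hy, ← reassoc_of% h1, Preadditive.sub_comp,
        Category.assoc, ha]
      simp
    rcases hL.2 (f ≫ a) with h | h
    · exact hf ⟨⟨a ≫ inv (f ≫ a), by rw [← Category.assoc, IsIso.hom_inv_id]⟩⟩
    · rw [← h6] at h
      exact hu ⟨⟨y ≫ inv (u ≫ y), by rw [← Category.assoc, IsIso.hom_inv_id]⟩⟩

end Pushout

/-! ### Construction of almost split sequences -/

namespace SerreFamily

variable {k : Type*} [Field k] {C : Type*} [Category* C] [Abelian C] [Linear k C]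
  {ι : Type*} {P I : ι → C} (S : SerreFamily k P I)

/-- Given a right almost split epimorphism whose kernel embeds into the injective object of a
Serre pair, there is one whose kernel is moreover indecomposable. -/
lemma exists_indecomposable_kernel {L E M P₁ I₁ : C} {f : L ⟶ E} {g : E ⟶ M} {w : f ≫ g = 0}
    (hS : (ShortComplex.mk f g w).ShortExact) (hg : IsRightAlmostSplit g)
    (S₁ : SerrePair k P₁ I₁) (j : L ⟶ I₁) [Mono j] :
    ∃ (L' E' : C) (f' : L' ⟶ E') (g' : E' ⟶ M) (w' : f' ≫ g' = 0),
      (ShortComplex.mk f' g' w').ShortExact ∧ IsRightAlmostSplit g' ∧ Indecomposable L' := by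
  have hfin := S₁.finite_left
  induction hn : Module.finrank k (P₁ ⟶ L) using Nat.strong_induction_on generalizing L E with
  | _ n ih =>
  by_cases hL : Indecomposable L
  · exact ⟨L, E, f, g, w, hS, hg, hL⟩
  have : Mono f := hS.mono_f
  have : Epi g := hS.epi_g
  have hL0 : ¬ IsZero L := fun h =>
    hg.1 (isSplitEpi_of_isSplitMono hS ⟨⟨0, h.eq_of_src _ _⟩⟩)
  obtain ⟨Y, Z, iso, hY, hZ⟩ : ∃ (Y Z : C) (_ : L ≅ Y ⊞ Z), ¬ IsZero Y ∧ ¬ IsZero Z := by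
    by_contra! h
    exact hL ⟨hL0, fun Y Z e => or_iff_not_imp_left.2 fun hY => h Y Z e hY⟩
  -- The section `s` embeds `Hom(P₁, Y)` in `Hom(P₁, L)`. If this were onto, all morphisms `P₁ ⟶ Z`
  -- would vanish after `b`. The pairing then gives `b ≫ j = 0`, so `b = 0` and `Z` is zero. This is
  -- where the embedding of `L` in `I₁` is needed.
  have small : ∀ {Y Z : C} (a : L ⟶ Y) (b : Z ⟶ L) (s : Y ⟶ L), s ≫ a = 𝟙 Y → b ≫ a = 0 →
      Mono b → ¬ IsZero Z → Module.finrank k (P₁ ⟶ Y) < n := by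
    intro Y Z a b s hs hb hm hZ
    have hlt : LinearMap.range (Linear.rightComp k P₁ s) < ⊤ := by
      refine lt_top_iff_ne_top.2 fun htop => hZ ?_
      have hbj : b ≫ j = 0 := S₁.right_nondeg _ fun u => by
        obtain ⟨y, hy⟩ : u ≫ b ∈ LinearMap.range (Linear.rightComp k P₁ s) :=
          htop ▸ Submodule.mem_top
        have hy' : y ≫ s = u ≫ b := hy
        have hy0 : y = 0 := by
          rw [← Category.comp_id y, ← hs, ← Category.assoc, hy', Category.assoc, hb, comp_zero]
        rw [← Category.assoc, ← hy', hy0, zero_comp, zero_comp, map_zero]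
      have hb0 : b = 0 := by rw [← cancel_mono j, hbj, zero_comp]
      rw [IsZero.iff_id_eq_zero, ← cancel_mono b, hb0, comp_zero, comp_zero]
    have hinj : Function.Injective (Linear.rightComp k P₁ s) := fun x y hxy => by
      have h1 : x ≫ s = y ≫ s := hxy
      rw [← Category.comp_id x, ← hs, ← Category.assoc, h1, Category.assoc, hs, Category.comp_id]
    rw [← LinearMap.finrank_range_of_inj hinj, ← hn]
    exact Submodule.finrank_lt hlt.ne
  -- Pushing out along a projection of `L` that does not extend along `f` keeps the sequence
  -- non-split. Lifts through `g` give lifts through `g'`, so right almost splitness persists while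
  -- the dimension drops.
  have step : ∀ {Y Z : C} (a : L ⟶ Y) (b : Z ⟶ L) (s : Y ⟶ L), s ≫ a = 𝟙 Y → b ≫ a = 0 →
      Mono b → ¬ IsZero Z → (¬ ∃ r : E ⟶ Y, f ≫ r = a) →
      ∃ (L' E' : C) (f' : L' ⟶ E') (g' : E' ⟶ M) (w' : f' ≫ g' = 0),
        (ShortComplex.mk f' g' w').ShortExact ∧ IsRightAlmostSplit g' ∧ Indecomposable L' := by
    intro Y Z a b s hs hb hm hZ hr
    obtain ⟨E', i, e, g', w', hS', h1, h2, h3⟩ := exists_pushout_shortExact hS a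
    have hg' : IsRightAlmostSplit g' := by
      refine ⟨fun h => hr (h3 h), fun X h hh => ?_⟩
      obtain ⟨l, hl⟩ := hg.2 X h hh
      exact ⟨l ≫ e, by rw [Category.assoc, h2, hl]⟩
    have : Mono s := by
      have : Mono (s ≫ a) := hs ▸ inferInstance
      exact mono_of_mono s a
    exact ih _ (small a b s hs hb hm hZ) hS' hg' (s ≫ j) rfl
  -- If both projections of `L` extended along `f`, they would combine to a retraction of `f`.
  by_cases hr₁ : ∃ r : E ⟶ Y, f ≫ r = iso.hom ≫ biprod.fst
  · by_cases hr₂ : ∃ r : E ⟶ Z, f ≫ r = iso.hom ≫ biprod.snd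
    · obtain ⟨r₁, h₁⟩ := hr₁
      obtain ⟨r₂, h₂⟩ := hr₂
      refine absurd (isSplitEpi_of_isSplitMono hS
        ⟨⟨biprod.lift r₁ r₂ ≫ iso.inv, ?_⟩⟩) hg.1
      have : f ≫ biprod.lift r₁ r₂ = iso.hom := by ext <;> simp [h₁, h₂]
      rw [reassoc_of% this, Iso.hom_inv_id]
    · exact step _ (biprod.inl ≫ iso.inv) (biprod.inr ≫ iso.inv) (by simp) (by simp)
        inferInstance hY hr₂
  · exact step _ (biprod.inr ≫ iso.inv) (biprod.inl ≫ iso.inv) (by simp) (by simp)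
      inferInstance hZ hr₁

include S in
/-- The Auslander-Reiten sequence ending in a non-projective object with local endomorphism ring
and a presentation by projective objects of Serre pairs. -/
theorem exists_almostSplit {M P₀ I₀ P₁ I₁ : C} (S₀ : SerrePair k P₀ I₀) (S₁ : SerrePair k P₁ I₁)
    (d : P₁ ⟶ P₀) (p : P₀ ⟶ M) [Epi p] (hdp : d ≫ p = 0)
    (hex : (ShortComplex.mk d p hdp).Exact) (hM : Indecomposable M) (hproj : ¬ Projective M) :
    ∃ (L E : C) (f : L ⟶ E) (g : E ⟶ M) (w : f ≫ g = 0),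
      IsAlmostSplitSequence (ShortComplex.mk f g w) := by
  have hloc := S.localEnd hM
  obtain ⟨νd, hν⟩ := S₁.exists_nakayama (S := S₀) d
  have hpinj : Function.Injective (Linear.leftComp k M p) := fun a b h => (cancel_epi p).1 h
  -- Since `p` is epi, `Hom(M, M)` embeds in `Hom(P₀, M)`, and the identity stays outside the image
  -- of the radical. This allows a functional `φ` that vanishes on that image but not at `p`.
  have hid : Linear.leftComp k M p (𝟙 M) ∉ (hloc.radical k).map (Linear.leftComp k M p) := by
    rintro ⟨r, hr, hr'⟩
    rw [hpinj hr'] at hr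
    exact hr inferInstance
  obtain ⟨φ, hφp, hφ⟩ := Submodule.exists_le_ker_of_notMem hid
  replace hφp : φ p ≠ 0 := by simpa using hφp
  replace hφ : ∀ r : M ⟶ M, ¬ IsIso r → φ (p ≫ r) = 0 := fun r hr => hφ ⟨r, hr, rfl⟩
  obtain ⟨θ, hθ⟩ := S₀.exists_right φ
  -- Through the pairings, `h ≫ θ` factors through `νd` as soon as the functional `u ↦ φ (u ≫ h)`
  -- factors through precomposition with `d`. This requires vanishing on the `u` with `d ≫ u = 0`,
  -- which by exactness are the `p ≫ m`.
  have lifts : ∀ {X : C} (h : X ⟶ M), (∀ m : M ⟶ X, φ (p ≫ m ≫ h) = 0) →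
      ∃ l : X ⟶ I₁, l ≫ νd = h ≫ θ := by
    intro X h hh
    have hle : LinearMap.ker (Linear.leftComp k X d) ≤
        LinearMap.ker (φ ∘ₗ Linear.rightComp k P₀ h) := by
      intro u hu
      have hu' : d ≫ u = 0 := hu
      have hm : p ≫ hex.desc u hu' = u := hex.g_desc u hu'
      rw [← hm, LinearMap.mem_ker]
      simpa using hh (hex.desc u hu')
    obtain ⟨ψ, hψ⟩ : ∃ ψ : (P₁ ⟶ X) →ₗ[k] k, ψ ∘ₗ Linear.leftComp k X d =
        φ ∘ₗ Linear.rightComp k P₀ h := by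
      have hmem := (Submodule.mem_dualAnnihilator _).2 hle
      rw [← LinearMap.range_dualMap_eq_dualAnnihilator_ker] at hmem
      exact hmem
    obtain ⟨l, hl⟩ := S₁.exists_right ψ
    refine ⟨l, S₀.hom_ext_right fun u => ?_⟩
    rw [← Category.assoc, hν, ← Category.assoc u, hθ, ← Category.assoc, hl]
    exact LinearMap.congr_fun hψ u
  let g := pullback.snd νd θ
  have hgM : ∀ {X : C} (h : X ⟶ M), (∃ l : X ⟶ I₁, l ≫ νd = h ≫ θ) → ∃ h', h' ≫ g = h :=
    fun h ⟨l, hl⟩ => ⟨pullback.lift l h hl, pullback.lift_snd _ _ _⟩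
  -- A section of `g` would factor `θ` through `νd`, and then `d ≫ p = 0` forces `φ p = 0`. If `h`
  -- is not a split epimorphism, no `m ≫ h` is invertible, so `lifts` applies.
  have hg : IsRightAlmostSplit g := by
    refine ⟨fun ⟨⟨σ, hσ⟩⟩ => hφp ?_, fun X h hh => hgM h (lifts h fun m => hφ _ fun hi => ?_)⟩
    · have h1 : θ = σ ≫ pullback.fst νd θ ≫ νd := by
        rw [pullback.condition, reassoc_of% hσ]
      have h2 : d ≫ p ≫ σ ≫ pullback.fst νd θ = 0 := by rw [reassoc_of% hdp, zero_comp]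
      have h3 := hν (p ≫ σ ≫ pullback.fst νd θ)
      rw [h2, map_zero] at h3
      rw [← hθ, h1, ← h3]
      simp
    · exact hh ⟨⟨inv (m ≫ h) ≫ m, by rw [Category.assoc, IsIso.inv_hom_id]⟩⟩
  -- Every `u : P i ⟶ M` lifts through `g`: an invertible `m ≫ u` would make `M` a retract of the
  -- projective `P i`.
  have hgepi : Epi g := by
    refine S.epi_of_lift g fun i u => hgM u (lifts u fun m => hφ _ fun hi => hproj ?_)
    have := (S.pair i).projective
    exact (Retract.mk m (u ≫ inv (m ≫ u))
      (by rw [← Category.assoc, IsIso.hom_inv_id])).projective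
  have hS : (ShortComplex.mk (kernel.ι g) g (kernel.condition g)).ShortExact :=
    ShortComplex.ShortExact.mk' (ShortComplex.exact_of_f_is_kernel _ (kernelIsKernel g))
      inferInstance hgepi
  -- The kernel of a pullback projection is detected in the other factor, here `I₁`.
  have hmono : Mono (kernel.ι g ≫ pullback.fst νd θ) := by
    refine Preadditive.mono_of_cancel_zero _ fun h hh => ?_
    rw [← cancel_mono (kernel.ι g), zero_comp]
    refine pullback.hom_ext (by simpa using hh) ?_
    rw [Category.assoc, kernel.condition, comp_zero, zero_comp]
  obtain ⟨L, E, f', g', w', hS', hg', hL⟩ := exists_indecomposable_kernel hS hg S₁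
    (kernel.ι g ≫ pullback.fst νd θ)
  exact ⟨L, E, f', g', w', hS', isLeftAlmostSplit_of_localEnd hS' hg' (S.localEnd hL), hg'⟩

end SerreFamily

/-! ### The Serre family of `mod A` -/

section Concrete

variable {k : Type v} [Field k] {A : Type u} [Category.{v} A] [Preadditive A] [Linear k A]
  [IsSpectroid k A]

omit [IsSpectroid k A] in
lemma hom_app_map_apply {X Y : LFDMod k A} (u : X ⟶ Y) {b c : A} (f : b ⟶ c) (x : X.obj.obj b) :
    u.hom.app c (X.obj.map f x) = Y.obj.map f (u.hom.app b x) :=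
  NatTrans.naturality_apply u.hom f x

/-- The morphism `P_a ⟶ X` given by an element of `X(a)`. -/
def projAtHom {X : LFDMod k A} {a : A} (x : X.obj.obj a) : projAt k a ⟶ X :=
  ObjectProperty.homMk
    { app := fun b => ModuleCat.ofHom
        { toFun := fun f : a ⟶ b => X.obj.map f x
          map_add' := fun f g => by
            have := X.property.additive
            simp
          map_smul' := fun r f => by
            have := X.property.linear
            simp }
      naturality := fun b c f => by
        ext g
        exact (congrArg (fun z => z x) (X.obj.map_comp g f) :) }

/-- The Yoneda isomorphism `Hom(P_a, X) ≃ X(a)`. -/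
def projAtEquiv (X : LFDMod k A) (a : A) : (projAt k a ⟶ X) ≃ₗ[k] X.obj.obj a where
  toFun u := u.hom.app a (𝟙 a)
  map_add' _ _ := rfl
  map_smul' _ _ := rfl
  invFun := projAtHom
  left_inv u := by
    ext b f
    refine (hom_app_map_apply u f (𝟙 a)).symm.trans ?_
    exact congrArg (u.hom.app b) (Category.id_comp f)
  right_inv x := by
    change X.obj.map (𝟙 a) x = x
    simp

lemma projAtHom_comp {X Y : LFDMod k A} {a : A} (x : X.obj.obj a) (h : X ⟶ Y) :
    projAtHom x ≫ h = projAtHom (h.hom.app a x) :=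
  (projAtEquiv Y a).injective (by
    change h.hom.app a (X.obj.map (𝟙 a) x) = Y.obj.map (𝟙 a) (h.hom.app a x)
    simp)

lemma projAtHom_surjective {X : LFDMod k A} {a : A} (u : projAt k a ⟶ X) :
    ∃ x, projAtHom x = u :=
  (projAtEquiv X a).symm.surjective u

/-- The morphism `X ⟶ I_a` given by a linear functional on `X(a)`. -/
def homInjAt {X : LFDMod k A} {a : A} (l : Module.Dual k (X.obj.obj a)) : X ⟶ injAt k a :=
  ObjectProperty.homMk
    { app := fun b => ModuleCat.ofHom
        (LinearMap.mk₂ k (fun (x : X.obj.obj b) (f : b ⟶ a) => l (X.obj.map f x))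
          (fun x y f => by simp) (fun r x f => by simp)
          (fun x f g => by
            have := X.property.additive
            simp)
          (fun r x f => by
            have := X.property.linear
            simp))
      naturality := fun b c f => by
        ext x
        refine LinearMap.ext fun g => ?_
        exact congrArg l (congrArg (fun z => z x) (X.obj.map_comp f g).symm :) }

lemma injAt_hom_app_apply {X : LFDMod k A} {a : A} (h : X ⟶ injAt k a) {b : A} (x : X.obj.obj b)
    (f : b ⟶ a) : (show Module.Dual k (b ⟶ a) from h.hom.app b x) f =
      (show Module.Dual k (a ⟶ a) from h.hom.app a (X.obj.map f x)) (𝟙 a) := by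
  rw [hom_app_map_apply]
  exact congrArg (show Module.Dual k (b ⟶ a) from h.hom.app b x) (Category.comp_id f).symm

/-- The isomorphism `Hom(X, I_a) ≃ D X(a)`. -/
def injAtEquiv (X : LFDMod k A) (a : A) : (X ⟶ injAt k a) ≃ₗ[k] Module.Dual k (X.obj.obj a) where
  toFun h :=
    { toFun := fun x => (show Module.Dual k (a ⟶ a) from h.hom.app a x) (𝟙 a)
      map_add' := fun x y => by
        rw [map_add]
        rfl
      map_smul' := fun r x => by
        rw [map_smul]
        rfl }
  map_add' _ _ := rfl
  map_smul' _ _ := rfl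
  invFun := homInjAt
  left_inv h := by
    ext b x
    exact LinearMap.ext fun f => (injAt_hom_app_apply h x f).symm
  right_inv l := by
    ext x
    change l (X.obj.map (𝟙 a) x) = l x
    simp

/-- The Serre pair formed by `P_a` and `I_a`. -/
def serrePairAt (a : A) : SerrePair k (projAt k a) (injAt k a) where
  t :=
    { toFun := fun h => injAtEquiv (projAt k a) a h (𝟙 a)
      map_add' := fun _ _ => rfl
      map_smul' := fun _ _ => rfl }
  finite_left X :=
    have := X.property.finite a
    Module.Finite.equiv (projAtEquiv X a).symm
  finite_right X :=
    have := X.property.finite a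
    Module.Finite.equiv (injAtEquiv X a).symm
  left_nondeg {X} u hu := by
    rw [← (projAtEquiv X a).map_eq_zero_iff, ← Module.forall_dual_apply_eq_zero_iff k]
    intro l
    obtain ⟨h, rfl⟩ := (injAtEquiv X a).surjective l
    exact hu h
  right_nondeg {X} h hh := by
    rw [← (injAtEquiv X a).map_eq_zero_iff]
    ext x
    obtain ⟨u, rfl⟩ := (projAtEquiv X a).surjective x
    exact hh u

variable (k A) in
/-- The Serre pairs `(P_a, I_a)` in `mod A`. -/
def serreFamily : SerreFamily k (fun a : A => projAt k a) (fun a => injAt k a) where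
  pair := serrePairAt
  separating {X Y} f hf := by
    ext a x
    obtain ⟨u, rfl⟩ := (projAtEquiv X a).surjective x
    exact congrArg (projAtEquiv Y a) (hf a u)
  dense {X Y} η hη := by
    refine ⟨ObjectProperty.homMk
      { app := fun a => ModuleCat.ofHom
          ((projAtEquiv Y a).toLinearMap ∘ₗ η a ∘ₗ (projAtEquiv X a).symm.toLinearMap)
        naturality := fun b c f => ?_ }, fun a u => ?_⟩
    · ext x
      -- By Yoneda, the action of `f` on a module is precomposition with `α`, so compatibility of
      -- `η` with the morphisms between the `P_a` is naturality in `A`.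
      let α : projAt k c ⟶ projAt k b := projAtHom (X := projAt k b) (a := c) f
      have hα : ∀ {Z : LFDMod k A} (u : projAt k b ⟶ Z),
          projAtEquiv Z c (α ≫ u) = Z.obj.map f (projAtEquiv Z b u) := fun {Z} u => by
        obtain ⟨z, rfl⟩ := projAtHom_surjective u
        refine (congrArg (projAtEquiv Z c)
          (projAtHom_comp (X := projAt k b) (a := c) f (projAtHom z))).trans ?_
        exact ((projAtEquiv Z c).right_inv _).trans
          (congrArg (Z.obj.map f) ((projAtEquiv Z b).right_inv z).symm)
      obtain ⟨u, rfl⟩ := (projAtEquiv X b).surjective x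
      change projAtEquiv Y c (η c ((projAtEquiv X c).symm (X.obj.map f (projAtEquiv X b u)))) =
        Y.obj.map f (projAtEquiv Y b (η b ((projAtEquiv X b).symm (projAtEquiv X b u))))
      rw [LinearEquiv.symm_apply_apply, ← hα, ← hα, LinearEquiv.symm_apply_apply, hη]
    · refine (projAtEquiv Y a).injective ?_
      change _ = projAtEquiv Y a (η a ((projAtEquiv X a).symm (projAtEquiv X a u)))
      rw [LinearEquiv.symm_apply_apply]

/-! ### Finite presentation and co-presentation in `mod A` -/

lemma finGen_iff_finGenBy (M : LFDMod k A) : FinGen M ↔ FinGenBy (fun a => projAt k a) M :=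
  finGenBy_iff_exists_epi.symm

lemma finCogen_iff_finGenBy_op (M : LFDMod k A) :
    FinCogen M ↔ FinGenBy (fun a : A => Opposite.op (injAt k a)) (Opposite.op M) := by
  refine ⟨fun ⟨r, a, j, hj⟩ =>
    ⟨r, a, fun i => (j ≫ biproduct.π (fun i => injAt k (a i)) i).op, fun Z h hh => ?_⟩,
    fun ⟨r, a, u, hu⟩ => ⟨r, a, biproduct.lift fun i => (u i).unop, ?_⟩⟩
  · refine Quiver.Hom.unop_inj ?_
    refine (Preadditive.mono_iff_cancel_zero j).1 hj _ h.unop (biproduct.hom_ext _ _ fun i => ?_)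
    rw [Category.assoc, zero_comp]
    exact congrArg Quiver.Hom.unop (hh i)
  · refine Preadditive.mono_of_cancel_zero _ fun {Z} h hh => ?_
    refine Quiver.Hom.op_inj (hu h.op fun i => Quiver.Hom.unop_inj ?_)
    have := congrArg (· ≫ biproduct.π _ i) hh
    simpa using this

/-- The target of a right almost split morphism is finitely presented. -/
lemma finPres_of_rightAlmostSplit {E M : LFDMod k A} {g : E ⟶ M} (hg : IsRightAlmostSplit g) :
    FinPres M := by
  obtain ⟨r, a, p, hp⟩ :=
    (finGen_iff_finGenBy M).2 ((serreFamily k A).finGenBy_of_rightAlmostSplit hg)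
  refine ⟨r, a, p, hp, (finGen_iff_finGenBy _).2 ?_⟩
  exact (serreFamily k A).exists_generators_of_rightAlmostSplit hg
    (SerrePair.biproduct fun i => serrePairAt (a i)) (kernel.ι p) p (kernel.condition p)
    (ShortComplex.ShortExact.mk' (ShortComplex.exact_of_f_is_kernel _ (kernelIsKernel p))
      inferInstance hp)
    ((finGen_iff_finGenBy _).1 ⟨r, a, 𝟙 _, inferInstance⟩)

lemma IsLeftAlmostSplit.op {C : Type*} [Category* C] {L E : C} {f : L ⟶ E}
    (hf : IsLeftAlmostSplit f) : IsRightAlmostSplit f.op := by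
  refine ⟨fun ⟨⟨σ, hσ⟩⟩ => hf.1 ⟨⟨σ.unop, Quiver.Hom.op_inj hσ⟩⟩, fun X h hh => ?_⟩
  obtain ⟨l, hl⟩ := hf.2 X.unop h.unop fun ⟨⟨σ, hσ⟩⟩ => hh ⟨⟨σ.op, Quiver.Hom.unop_inj hσ⟩⟩
  exact ⟨l.op, Quiver.Hom.unop_inj hl⟩

lemma IsLeftAlmostSplit.unop {C : Type*} [Category* C] {L E : Cᵒᵖ} {f : L ⟶ E}
    (hf : IsLeftAlmostSplit f) : IsRightAlmostSplit f.unop := by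
  refine ⟨fun ⟨⟨σ, hσ⟩⟩ => hf.1 ⟨⟨σ.op, Quiver.Hom.unop_inj hσ⟩⟩, fun X h hh => ?_⟩
  obtain ⟨l, hl⟩ := hf.2 (Opposite.op X) h.op fun ⟨⟨σ, hσ⟩⟩ =>
    hh ⟨⟨σ.unop, Quiver.Hom.op_inj hσ⟩⟩
  exact ⟨l.unop, Quiver.Hom.op_inj hl⟩

lemma IsRightAlmostSplit.unop {C : Type*} [Category* C] {E N : Cᵒᵖ} {g : E ⟶ N}
    (hg : IsRightAlmostSplit g) : IsLeftAlmostSplit g.unop := by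
  refine ⟨fun ⟨⟨σ, hσ⟩⟩ => hg.1 ⟨⟨σ.op, Quiver.Hom.unop_inj hσ⟩⟩, fun X h hh => ?_⟩
  obtain ⟨l, hl⟩ := hg.2 (Opposite.op X) h.op fun ⟨⟨σ, hσ⟩⟩ =>
    hh ⟨⟨σ.unop, Quiver.Hom.op_inj hσ⟩⟩
  exact ⟨l.unop, Quiver.Hom.op_inj hl⟩

/-- The source of a left almost split morphism is finitely co-presented. -/
lemma finCopres_of_leftAlmostSplit {M E : LFDMod k A} {f : M ⟶ E} (hf : IsLeftAlmostSplit f) :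
    FinCopres M := by
  obtain ⟨r, a, j, hj⟩ := (finCogen_iff_finGenBy_op M).2
    ((serreFamily k A).op.finGenBy_of_rightAlmostSplit hf.op)
  refine ⟨r, a, j, hj, (finCogen_iff_finGenBy_op _).2 ?_⟩
  have hS : (ShortComplex.mk j (cokernel.π j) (cokernel.condition j)).ShortExact :=
    ShortComplex.ShortExact.mk' (ShortComplex.exact_of_g_is_cokernel _ (cokernelIsCokernel j))
      hj inferInstance
  exact (serreFamily k A).op.exists_generators_of_rightAlmostSplit hf.op
    (SerrePair.biproduct fun i => serrePairAt (a i)).op (cokernel.π j).op j.op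
    (by rw [← op_comp, cokernel.condition, op_zero]) hS.op
    ((finCogen_iff_finGenBy_op _).1 ⟨r, a, 𝟙 _, inferInstance⟩)

lemma exists_almostSplit_of_finPres {M : LFDMod k A} (hM : Indecomposable M)
    (hproj : ¬ Projective M) (h : FinPres M) :
    ∃ (L E : LFDMod k A) (f : L ⟶ E) (g : E ⟶ M) (w : f ≫ g = 0),
      IsAlmostSplitSequence (ShortComplex.mk f g w) := by
  obtain ⟨r, a, p, hp, r', a', q, hq⟩ := h
  have w : (q ≫ kernel.ι p) ≫ p = 0 := by simp
  refine (serreFamily k A).exists_almostSplit (SerrePair.biproduct fun i => serrePairAt (a i))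
    (SerrePair.biproduct fun i => serrePairAt (a' i)) (q ≫ kernel.ι p) p w ?_ hM hproj
  -- Replacing the kernel of `p` by an object mapping onto it preserves exactness in the middle.
  let φ : ShortComplex.mk (q ≫ kernel.ι p) p w ⟶
      ShortComplex.mk (kernel.ι p) p (kernel.condition p) := { τ₁ := q, τ₂ := 𝟙 _, τ₃ := 𝟙 _ }
  have : Epi φ.τ₁ := hq
  have : IsIso φ.τ₂ := inferInstanceAs (IsIso (𝟙 _))
  have : Mono φ.τ₃ := inferInstanceAs (Mono (𝟙 _))
  exact (ShortComplex.exact_iff_of_epi_of_isIso_of_mono φ).2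
    (ShortComplex.exact_of_f_is_kernel _ (kernelIsKernel p))

lemma exists_almostSplit_of_finCopres {M : LFDMod k A} (hM : Indecomposable M)
    (hinj : ¬ Injective M) (h : FinCopres M) :
    ∃ (E N : LFDMod k A) (f : M ⟶ E) (g : E ⟶ N) (w : f ≫ g = 0),
      IsAlmostSplitSequence (ShortComplex.mk f g w) := by
  obtain ⟨r, a, j, hj, r', a', q, hq⟩ := h
  have w : j ≫ (cokernel.π j ≫ q) = 0 := by simp
  have hex : (ShortComplex.mk j (cokernel.π j ≫ q) w).Exact := by
    let φ : ShortComplex.mk j (cokernel.π j) (cokernel.condition j) ⟶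
        ShortComplex.mk j (cokernel.π j ≫ q) w := { τ₁ := 𝟙 _, τ₂ := 𝟙 _, τ₃ := q }
    have : Epi φ.τ₁ := inferInstanceAs (Epi (𝟙 _))
    have : IsIso φ.τ₂ := inferInstanceAs (IsIso (𝟙 _))
    have : Mono φ.τ₃ := hq
    exact (ShortComplex.exact_iff_of_epi_of_isIso_of_mono φ).1
      (ShortComplex.exact_of_g_is_cokernel _ (cokernelIsCokernel j))
  -- In the opposite category the co-presentation of `M` becomes a presentation by the objects `op
  -- (I_b)`, which are the projective members of the dual Serre pairs.
  obtain ⟨L, E, f, g, w', h⟩ := (serreFamily k A).op.exists_almostSplit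
    (SerrePair.biproduct fun i => serrePairAt (a i)).op
    (SerrePair.biproduct fun i => serrePairAt (a' i)).op (cokernel.π j ≫ q).op j.op
    (by rw [← op_comp, w, op_zero]) hex.op (Indecomposable.op hM)
    (fun h => hinj ((Injective.injective_iff_projective_op).2 h))
  exact ⟨E.unop, L.unop, g.unop, f.unop, by rw [← unop_comp, w', unop_zero],
    h.shortExact.unop, h.right.unop, h.left.unop⟩

end Concrete

end LocFin

theorem corollary4p2 {k : Type v} [Field k] [IsAlgClosed k] {A : Type u} [Category.{v} A]
    [Preadditive A] [Linear k A] [LocFin.IsSpectroid k A] (M : LocFin.LFDMod k A)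
    (hM : Indecomposable M) :
    (¬ Projective M →
      ((∃ (L E : LocFin.LFDMod k A) (f : L ⟶ E) (g : E ⟶ M) (w : f ≫ g = 0),
          LocFin.IsAlmostSplitSequence (ShortComplex.mk f g w)) ↔ LocFin.FinPres M)) ∧
    (¬ Injective M →
      ((∃ (E N : LocFin.LFDMod k A) (f : M ⟶ E) (g : E ⟶ N) (w : f ≫ g = 0),
          LocFin.IsAlmostSplitSequence (ShortComplex.mk f g w)) ↔ LocFin.FinCopres M)) :=
  ⟨fun h => ⟨fun ⟨_, _, _, _, _, hs⟩ => LocFin.finPres_of_rightAlmostSplit hs.right,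
      LocFin.exists_almostSplit_of_finPres hM h⟩,
    fun h => ⟨fun ⟨_, _, _, _, _, hs⟩ => LocFin.finCopres_of_leftAlmostSplit hs.left,
      LocFin.exists_almostSplit_of_finCopres hM h⟩⟩
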